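/- For $b \ge 0$ consider the planar system $$\dot x = y,\qquad \dot y = -x + (b^2 - x^2)(y + y^3). \tag{2}$$ (I) If $b \neq 1$, the hyperbola $xy + 1 = 0$ is without contact for the flow of (2), that is, at each of its points the vector field of (2) is not tangent to it (in particular, does not vanish). In particular, no periodic orbit of (2) meets the hyperbola. (II) If $b = 1$, the hyperbola $xy + 1 = 0$ is invariant for the flow of (2), that is, a solution having a point on it stays on it as long as it is defined, in the past and in the future; and (2) has no periodic orbits. Here a periodic orbit is the image of a nonconstant periodic solution. -/

import Mathlib

/-- The vector field `(P, Q)` of the planar system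
`x' = y`, `y' = -x + (b ^ 2 - x ^ 2) * (y + y ^ 3)`. -/
def quinticField (b : ℝ) (p : ℝ × ℝ) : ℝ × ℝ :=
  (p.2, -p.1 + (b ^ 2 - p.1 ^ 2) * (p.2 + p.2 ^ 3))

/-- The hyperbola `x * y + 1 = 0`. -/
def hyperbola : Set (ℝ × ℝ) :=
  {p | p.1 * p.2 + 1 = 0}

/-- The planar curve `C` is without contact for the flow of `X`: at each of its points, `C` has a
tangent line, and the vector `X p` does not lie on (the direction of) this line. In particular
`X` has no zero on `C`. -/
def IsWithoutContact (X : ℝ × ℝ → ℝ × ℝ) (C : Set (ℝ × ℝ)) : Prop :=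
  ∀ p ∈ C, ∃ v : ℝ × ℝ, v ≠ 0 ∧
    tangentConeAt ℝ C p = (Submodule.span ℝ {v} : Set (ℝ × ℝ)) ∧
    X p ∉ Submodule.span ℝ {v}

/-- `Γ` is a periodic orbit of `X`: the image of a nonconstant periodic solution of `γ' = X(γ)`.
Equilibrium points are not periodic orbits. -/
def IsPeriodicOrbit (X : ℝ × ℝ → ℝ × ℝ) (Γ : Set (ℝ × ℝ)) : Prop :=
  ∃ (γ : ℝ → ℝ × ℝ) (T : ℝ), 0 < T ∧ IsIntegralCurve γ (fun _ => X) ∧ Function.Periodic γ T ∧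
    (∃ s t : ℝ, γ s ≠ γ t) ∧ Γ = Set.range γ

/-- `C` is invariant for the flow of `X`: a solution, on any open interval `I` (solutions
need not exist for all times), that meets `C` at some time lies in `C` at all times of `I`, both
in the past and in the future. -/
def IsFlowInvariant (X : ℝ × ℝ → ℝ × ℝ) (C : Set (ℝ × ℝ)) : Prop :=
  ∀ (I : Set ℝ) (γ : ℝ → ℝ × ℝ), IsOpen I → I.OrdConnected →
    IsIntegralCurveOn γ (fun _ => X) I →
    ∀ t₀ ∈ I, γ t₀ ∈ C → ∀ t ∈ I, γ t ∈ C

/-!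
Write `F = x * y + 1` and let `(x, y)` be a solution of the system.

The tangent line of the hyperbola at `(x, y)` is spanned by `(x, -y)`, and on the hyperbola
`F' = (1 - b ^ 2) * (1 + y ^ 2)`. If `b ≠ 1`, this has a constant nonzero sign, so the field is
nowhere tangent to the hyperbola, and a solution can only cross it in one direction, which a
periodic solution cannot do (`Function.Periodic.ne_zero_of_deriv_pos`).

If `b = 1`, then `F' = K * F` with `K = y ^ 2 - x ^ 2 - x ^ 2 * y ^ 2 + x * y`. A solution of a
linear equation that vanishes once vanishes identically, so `F = 0` is invariant. On a periodic
solution, Rolle's theorem for `x` gives a time at which `y = 0`, hence `F = 1`; by invariance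
`F > 0` at all times. On the region `F > 0` the function
`H = exp (3 * x ^ 2 / 2) * ((y / F) ^ 2 / 2 + 1 / 3)` satisfies
`H' = exp (3 * x ^ 2 / 2) * (y / F) ^ 2 * (1 + 2 * x ^ 2) * (1 + x * y / 2) ≥ 0`, with equality
only for `y = 0`. Since `H` is periodic along the solution, `H'` vanishes, so `y` vanishes
identically and the solution is constant.

The function `H` comes from a Dulac function: `B = exp (3 * x ^ 2 / 2) / F ^ 3` satisfies
`div (B * X) = (1 + 2 * x ^ 2) * B`. Integrating this divergence in `y` turns the Dulac criterion
into the monotonicity of `H`, where `∂H/∂y = B * y`, because `x' = y`.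
-/

/-! ### Periodic functions of one real variable -/

/-- The derivative of a periodic function cannot be positive at all of its zeros unless there are
none: after a zero the function stays nonnegative, so the next translate of the zero by the period
is a local minimum. -/
theorem Function.Periodic.ne_zero_of_deriv_pos {g g' : ℝ → ℝ} {T : ℝ} (hT : 0 < T)
    (hper : Function.Periodic g T) (hg : ∀ t, HasDerivAt g (g' t) t)
    (hpos : ∀ t, g t = 0 → 0 < g' t) (t₀ : ℝ) : g t₀ ≠ 0 := by
  intro h0
  have hnn : ∀ ⦃t⦄, t ∈ Set.Icc t₀ (t₀ + 2 * T) → -g t ≤ 0 :=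
    image_le_of_deriv_right_lt_deriv_boundary (f' := fun t => -g' t) (B := fun _ => 0)
      (B' := fun _ => 0)
      (fun t _ => (hg t).neg.continuousAt.continuousWithinAt)
      (fun t _ => (hg t).neg.hasDerivWithinAt) (by simp [h0])
      (fun t => hasDerivAt_const t 0)
      (fun t _ ht => by have := hpos t (neg_eq_zero.mp ht); linarith)
  have h1 : g (t₀ + T) = 0 := (hper t₀).trans h0
  have hmin : IsLocalMin g (t₀ + T) := by
    filter_upwards [Icc_mem_nhds (show t₀ < t₀ + T by linarith)
      (show t₀ + T < t₀ + 2 * T by linarith)] with t ht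
    rw [h1]
    linarith [hnn ht]
  exact (hpos _ h1).ne' (hmin.hasDerivAt_eq_zero (hg _))

/-- A periodic function with nonnegative derivative has zero derivative: by monotonicity, the
value one period ahead bounds the function, so every point is a local maximum. -/
theorem Function.Periodic.deriv_eq_zero_of_nonneg {g g' : ℝ → ℝ} {T : ℝ} (hT : 0 < T)
    (hper : Function.Periodic g T) (hg : ∀ t, HasDerivAt g (g' t) t) (hnn : ∀ t, 0 ≤ g' t)
    (t : ℝ) : g' t = 0 := by
  have hmono : Monotone g := monotone_of_deriv_nonneg (fun s => (hg s).differentiableAt)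
    (fun s => by rw [(hg s).deriv]; exact hnn s)
  have hmax : IsLocalMax g t := by
    filter_upwards [Iic_mem_nhds (show t < t + T by linarith)] with s hs
    exact (hmono hs).trans_eq (hper t)
  exact hmax.hasDerivAt_eq_zero (hg t)

/-! ### Homogeneous linear equations -/

/-- On an open interval, a solution of `g' = k * g` with `k` continuous that vanishes at one time
vanishes at all times: `g * exp (-∫ k)` is constant. -/
theorem eq_zero_of_hasDerivAt_mul_self {I : Set ℝ} (hI : IsOpen I) (hI' : I.OrdConnected)
    {g k : ℝ → ℝ} (hk : ContinuousOn k I) (hg : ∀ t ∈ I, HasDerivAt g (k t * g t) t)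
    {t₀ : ℝ} (ht₀ : t₀ ∈ I) (h0 : g t₀ = 0) {t : ℝ} (ht : t ∈ I) : g t = 0 := by
  have hA : ∀ s ∈ I, HasDerivAt (fun u => ∫ r in t₀..u, k r) (k s) s := fun s hs =>
    intervalIntegral.integral_hasDerivAt_right
      ((hk.mono (hI'.uIcc_subset ht₀ hs)).intervalIntegrable)
      (hk.stronglyMeasurableAtFilter hI s hs) (hk.continuousAt (hI.mem_nhds hs))
  have hd : ∀ s ∈ I, HasDerivAt (fun u => g u * Real.exp (-∫ r in t₀..u, k r)) 0 s :=
    fun s hs => ((hg s hs).mul (hA s hs).neg.exp).congr_deriv (by simp only [Pi.neg_apply]; ring)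
  have hconst := hI.is_const_of_deriv_eq_zero hI'.isPreconnected
    (fun s hs => (hd s hs).differentiableAt.differentiableWithinAt)
    (fun s hs => (hd s hs).deriv) ht ht₀
  simpa [h0, (Real.exp_pos _).ne'] using hconst

/-! ### The tangent lines of the hyperbola -/

theorem hasFDerivAt_fst_mul_snd_add_one (p : ℝ × ℝ) :
    HasFDerivAt (fun q : ℝ × ℝ => q.1 * q.2 + 1)
      (p.1 • ContinuousLinearMap.snd ℝ ℝ ℝ + p.2 • ContinuousLinearMap.fst ℝ ℝ ℝ) p :=
  ((hasFDerivAt_fst (𝕜 := ℝ) (p := p)).mul (hasFDerivAt_snd (𝕜 := ℝ) (p := p))).add_const 1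

theorem tangentConeAt_hyperbola {p : ℝ × ℝ} (hp : p ∈ hyperbola) :
    tangentConeAt ℝ hyperbola p = (Submodule.span ℝ {(p.1, -p.2)} : Set (ℝ × ℝ)) := by
  have hp' : p.1 * p.2 + 1 = 0 := hp
  apply Set.Subset.antisymm
  · intro w hw
    -- The equation `x * y + 1 = 0` maps the hyperbola to a point, so its differential kills `w`.
    have h1 := (hasFDerivAt_fst_mul_snd_add_one p).hasFDerivWithinAt.mapsTo_tangent_cone hw
    have himg : (fun q : ℝ × ℝ => q.1 * q.2 + 1) '' hyperbola ⊆ {0} := by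
      rintro _ ⟨q, hq, rfl⟩
      exact hq
    have hacc : ¬ AccPt (p.1 * p.2 + 1) (Filter.principal ({0} : Set ℝ)) :=
      fun h => Set.Infinite.of_accPt h (Set.finite_singleton 0)
    have h2 : p.1 * w.2 + p.2 * w.1 = 0 := by
      simpa using tangentConeAt_subset_zero hacc (tangentConeAt_mono himg h1)
    refine Submodule.mem_span_singleton.mpr ⟨-p.2 * w.1, ?_⟩
    ext
    · simp only [Prod.smul_mk, smul_eq_mul]
      linear_combination -w.1 * hp'
    · simp only [Prod.smul_mk, smul_eq_mul]
      linear_combination p.2 * h2 - w.2 * hp'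
  · intro w hw
    obtain ⟨c, rfl⟩ := Submodule.mem_span_singleton.mp hw
    -- The curve `t ↦ (x * exp t, y * exp (-t))` runs on the hyperbola with velocity `(x, -y)`.
    have hcurve : HasDerivAt (fun t : ℝ => (p.1 * Real.exp t, p.2 * Real.exp (-t)))
        (p.1, -p.2) 0 := by
      refine HasDerivAt.prodMk ?_ ?_
      · simpa using (Real.hasDerivAt_exp 0).const_mul p.1
      · simpa using (hasDerivAt_neg (0 : ℝ)).exp.const_mul p.2
    have h1 := hcurve.hasFDerivAt.hasFDerivWithinAt (s := Set.univ).mapsTo_tangent_cone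
      (show c ∈ tangentConeAt ℝ Set.univ (0 : ℝ) by rw [tangentConeAt_univ]; trivial)
    have himg : (fun t : ℝ => (p.1 * Real.exp t, p.2 * Real.exp (-t))) '' Set.univ
        ⊆ hyperbola := by
      rintro _ ⟨t, -, rfl⟩
      have he : Real.exp t * Real.exp (-t) = 1 := by rw [← Real.exp_add]; simp
      change p.1 * Real.exp t * (p.2 * Real.exp (-t)) + 1 = 0
      linear_combination hp' + p.1 * p.2 * he
    simpa using tangentConeAt_mono himg h1

theorem isWithoutContact_hyperbola {b : ℝ} (hb : b ^ 2 ≠ 1) :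
    IsWithoutContact (quinticField b) hyperbola := by
  intro p hp
  have hp' : p.1 * p.2 + 1 = 0 := hp
  refine ⟨(p.1, -p.2), ?_, tangentConeAt_hyperbola hp, ?_⟩
  · intro h
    have h1 : p.1 = 0 := congrArg Prod.fst h
    simp [h1] at hp'
  · intro h
    obtain ⟨c, hc⟩ := Submodule.mem_span_singleton.mp h
    have h1 : c * p.1 = p.2 := congrArg Prod.fst hc
    have h2 : c * -p.2 = -p.1 + (b ^ 2 - p.1 ^ 2) * (p.2 + p.2 ^ 3) := congrArg Prod.snd hc
    -- Pairing the field with the gradient `(y, x)` of `x * y + 1`.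
    have h3 : (1 - b ^ 2) * (1 + p.2 ^ 2) = 0 := by
      linear_combination (-p.2) * h1 - p.1 * h2
        - ((b ^ 2 - p.1 ^ 2) * (1 + p.2 ^ 2) + p.1 * p.2 - 1) * hp'
    rcases mul_eq_zero.mp h3 with h | h
    · exact hb (by linarith)
    · nlinarith [sq_nonneg p.2]

/-! ### Evolution of `x * y + 1` along solutions -/

/-- On the hyperbola this derivative equals `(1 - b ^ 2) * (1 + y ^ 2)`. -/
theorem HasDerivAt.fst_mul_snd_add_one {b t : ℝ} {γ : ℝ → ℝ × ℝ}
    (h : HasDerivAt γ (quinticField b (γ t)) t) :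
    HasDerivAt (fun s => (γ s).1 * (γ s).2 + 1)
      ((γ t).2 * (γ t).2
        + (γ t).1 * (-(γ t).1 + (b ^ 2 - (γ t).1 ^ 2) * ((γ t).2 + (γ t).2 ^ 3))) t := by
  have hx : HasDerivAt (fun s => (γ s).1) (γ t).2 t := h.fst
  have hy : HasDerivAt (fun s => (γ s).2)
    (-(γ t).1 + (b ^ 2 - (γ t).1 ^ 2) * ((γ t).2 + (γ t).2 ^ 3)) t := h.snd
  exact (hx.mul hy).add_const 1

theorem inter_hyperbola_eq_empty_of_isPeriodicOrbit {b : ℝ} (hb : b ^ 2 ≠ 1)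
    {Γ : Set (ℝ × ℝ)} (hΓ : IsPeriodicOrbit (quinticField b) Γ) : Γ ∩ hyperbola = ∅ := by
  obtain ⟨γ, T, hT, hγ, hper, -, rfl⟩ := hΓ
  -- The derivative of `(1 - b ^ 2) * (x * y + 1)` is positive at every zero.
  have hderiv := fun t => (hγ t).fst_mul_snd_add_one.const_mul (1 - b ^ 2)
  have hne := Function.Periodic.ne_zero_of_deriv_pos hT
    (fun t => by simp only [hper t]) hderiv (fun t ht => by
      have hb' : 1 - b ^ 2 ≠ 0 := fun h => hb (by linarith)
      have h0 : (γ t).1 * (γ t).2 + 1 = 0 := (mul_eq_zero.mp ht).resolve_left hb'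
      have h1 : (γ t).2 * (γ t).2
          + (γ t).1 * (-(γ t).1 + (b ^ 2 - (γ t).1 ^ 2) * ((γ t).2 + (γ t).2 ^ 3))
          = (1 - b ^ 2) * (1 + (γ t).2 ^ 2) := by
        linear_combination ((b ^ 2 - (γ t).1 ^ 2) * (1 + (γ t).2 ^ 2)
          + (γ t).1 * (γ t).2 - 1) * h0
      rw [h1, ← mul_assoc]
      have := mul_self_pos.mpr hb'
      positivity)
  rw [Set.eq_empty_iff_forall_notMem]
  rintro _ ⟨⟨t, rfl⟩, ht⟩
  have h0 : (γ t).1 * (γ t).2 + 1 = 0 := ht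
  exact hne t (by rw [h0, mul_zero])

theorem isFlowInvariant_hyperbola : IsFlowInvariant (quinticField 1) hyperbola := by
  intro I γ hI hI' hγ t₀ ht₀ h0 t ht
  have hγ' : ∀ s ∈ I, HasDerivAt γ (quinticField 1 (γ s)) s :=
    fun s hs => (hγ s hs).hasDerivAt (hI.mem_nhds hs)
  have hcont : ContinuousOn γ I := fun s hs => (hγ s hs).continuousWithinAt
  -- The cofactor of the invariant curve `x * y + 1 = 0`.
  exact eq_zero_of_hasDerivAt_mul_self hI hI' (g := fun s => (γ s).1 * (γ s).2 + 1)
    (k := fun s => (γ s).2 ^ 2 - (γ s).1 ^ 2 - (γ s).1 ^ 2 * (γ s).2 ^ 2 + (γ s).1 * (γ s).2)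
    (by fun_prop) (fun s hs => (hγ' s hs).fst_mul_snd_add_one.congr_deriv (by ring)) ht₀ h0 ht

/-! ### Absence of periodic orbits for `b = 1` -/

/-- A function increasing along the solutions with `b = 1` in the region `x * y + 1 > 0`. -/
noncomputable def lyapunov (p : ℝ × ℝ) : ℝ :=
  Real.exp (3 / 2 * p.1 ^ 2) * ((p.2 / (p.1 * p.2 + 1)) ^ 2 / 2 + 1 / 3)

theorem HasDerivAt.lyapunov {t : ℝ} {γ : ℝ → ℝ × ℝ}
    (h : HasDerivAt γ (quinticField 1 (γ t)) t) (h0 : (γ t).1 * (γ t).2 + 1 ≠ 0) :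
    HasDerivAt (fun s => lyapunov (γ s))
      (Real.exp (3 / 2 * (γ t).1 ^ 2) * ((γ t).2 / ((γ t).1 * (γ t).2 + 1)) ^ 2
        * ((1 + 2 * (γ t).1 ^ 2) * (1 + (γ t).1 * (γ t).2 / 2))) t := by
  have hx : HasDerivAt (fun s => (γ s).1) (γ t).2 t := h.fst
  have hy : HasDerivAt (fun s => (γ s).2)
    (-(γ t).1 + (1 ^ 2 - (γ t).1 ^ 2) * ((γ t).2 + (γ t).2 ^ 3)) t := h.snd
  refine (((hx.pow 2).const_mul (3 / 2)).exp.mul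
    ((((hy.div h.fst_mul_snd_add_one h0).pow 2).div_const 2).add_const (1 / 3))).congr_deriv ?_
  simp only [Pi.div_apply, Pi.pow_apply, Nat.reduceSub, pow_one, Nat.cast_ofNat]
  field_simp
  ring

/-- A periodic solution reaches `y = 0`, so it stays in the region `x * y + 1 > 0`, where
`lyapunov` is monotone along it, strictly unless `y` vanishes identically. -/
theorem not_isPeriodicOrbit_quinticField_one (Γ : Set (ℝ × ℝ)) :
    ¬ IsPeriodicOrbit (quinticField 1) Γ := by
  rintro ⟨γ, T, hT, hγ, hper, ⟨s, t, hst⟩, -⟩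
  have hcont : Continuous γ := continuous_iff_continuousAt.mpr fun t => (hγ t).continuousAt
  have hx : ∀ t, HasDerivAt (fun s => (γ s).1) (γ t).2 t := fun t => (hγ t).fst
  obtain ⟨c, -, hc⟩ : ∃ c ∈ Set.Ioo 0 T, (γ c).2 = 0 :=
    exists_hasDerivAt_eq_zero hT (by fun_prop) (by simpa using congrArg Prod.fst (hper 0).symm)
      (fun t _ => hx t)
  have hne : ∀ t, (γ t).1 * (γ t).2 + 1 ≠ 0 := by
    intro t ht
    have h1 : (γ c).1 * (γ c).2 + 1 = 0 :=
      isFlowInvariant_hyperbola Set.univ γ isOpen_univ Set.ordConnected_univ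
        (fun s _ => (hγ s).hasDerivWithinAt) t trivial ht c trivial
    simp [hc] at h1
  have hpos : ∀ t, 0 < (γ t).1 * (γ t).2 + 1 := by
    intro t
    by_contra! ht
    obtain ⟨s, hs⟩ := mem_range_of_exists_le_of_exists_ge
      (show Continuous fun s => (γ s).1 * (γ s).2 + 1 by fun_prop) ⟨t, ht⟩ ⟨c, by simp [hc]⟩
    exact hne s hs
  have hfac : ∀ t, 0 < (1 + 2 * (γ t).1 ^ 2) * (1 + (γ t).1 * (γ t).2 / 2) := fun t =>
    mul_pos (by positivity) (by linarith [hpos t])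
  have hzero := Function.Periodic.deriv_eq_zero_of_nonneg hT
    (fun t => by simp only [hper t]) (fun t => (hγ t).lyapunov (hne t))
    (fun t => mul_nonneg (by positivity) (hfac t).le)
  have hy : ∀ t, (γ t).2 = 0 := by
    intro t
    simpa [(hfac t).ne', Real.exp_ne_zero, hne t] using
      (mul_eq_zero.mp (hzero t)).resolve_right (hfac t).ne'
  have hxc : (γ s).1 = (γ t).1 := is_const_of_deriv_eq_zero (fun t => (hx t).differentiableAt)
    (fun t => (hx t).deriv.trans (hy t)) s t
  exact hst (Prod.ext hxc ((hy s).trans (hy t).symm))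

theorem lemma4p3 (b : ℝ) (hb : 0 ≤ b) :
    (b ≠ 1 →
      IsWithoutContact (quinticField b) hyperbola ∧
      ∀ Γ : Set (ℝ × ℝ), IsPeriodicOrbit (quinticField b) Γ → Γ ∩ hyperbola = ∅) ∧
    (b = 1 →
      IsFlowInvariant (quinticField b) hyperbola ∧
      ¬ ∃ Γ : Set (ℝ × ℝ), IsPeriodicOrbit (quinticField b) Γ) := by
  refine ⟨fun h => ?_, ?_⟩
  · have hb2 : b ^ 2 ≠ 1 := fun h2 => h ((pow_eq_one_iff_of_nonneg hb two_ne_zero).mp h2)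
    exact ⟨isWithoutContact_hyperbola hb2,
      fun Γ hΓ => inter_hyperbola_eq_empty_of_isPeriodicOrbit hb2 hΓ⟩
  · rintro rfl
    exact ⟨isFlowInvariant_hyperbola, fun ⟨Γ, hΓ⟩ => not_isPeriodicOrbit_quinticField_one Γ hΓ⟩
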